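/- Let $k\ge 1$, let $M_k=\{e_1,\dots,e_k,f_1,\dots,f_k\}$ be a set of markers, and let the Rabin language $\mathcal R_k\subseteq (2^{M_k})^\omega$ be the set of words $\alpha_0\alpha_1\alpha_2\cdots$ for which there is a $j$ such that $e_j\in\alpha_i$ for infinitely many $i$ and $f_j\in\alpha_i$ for only finitely many $i$. A (partially observable) Markov chain over a set $\Sigma$ of observations has a finite state set $S$, an initial state $s_{in}$, an observation function $\mathrm{Obs}:S\to\Sigma$ and a transition probability matrix. A black-box strategy is a function $\sigma:(\Sigma\times\{r,c\})^*\Sigma\to\{r,c\}$ that chooses, from the observations and actions so far, whether to restart ($r$: the chain is put back into $s_{in}$) or to continue ($c$: the chain makes one step). Together with a Markov chain $\mathcal M$ it induces a Markov chain on the finite histories $(S\times\{r,c\})^*\times S$. If a run of the induced chain has finitely many restarts, its tail is the infinite sequence of observations made from the last restart on (from the beginning if there is no restart). The strategy $\sigma$ is a testing strategy for a language $L\subseteq\Sigma^\omega$ if for every finite Markov chain $\mathcal M$ over $\Sigma$ such that the observation sequence of a run of $\mathcal M$ lies in $L$ with positive probability, with probability 1 a run of the chain induced by $\sigma$ and $\mathcal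 M$ has finitely many restarts and its tail belongs to $L$. The length of a finite path $\pi=s_0\cdots s_m$ is $m$, and its second half is $s_{\lceil m/2\rceil}\cdots s_m$. A finite path over $2^{M_k}$ is good if it has length $0$, or if for some $1\le i\le k$ some state of the path has $e_i$ in its observation and no state of the path has $f_i$ in its observation. For $f:\mathbb N\to\mathbb N$, the strategy $\mathfrak S[f]$ over $2^{M_k}$ does the following after the $n$-th restart ($n=0$ at the beginning): it samples the chain in blocks of $2f(n)$ steps; whenever the path $\pi$ sampled since the $n$-th restart consists of complete blocks, it restarts if the second half of $\pi$ is not good, and otherwise it samples another block. (If $f(n)=0$, so that the blocks are empty, it restarts immediately.) Theorem. For every $k\ge1$ and every $f:\mathbb N\to\mathbb N$, the strategy $\mathfrak S[f]$ is a testing strategy for $\mathcal R_k$ if and only if $\limsup_{n\to\infty}f(n)=\infty$. -/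

import Mathlib

noncomputable section

namespace BlackBoxTesting

/-! ### Partially observable Markov chains -/

/-- A Markov chain with state set `S`, initial state `init`, observation function `obs` into `O`,
and a transition probability distribution `P s` for every state `s`.  Finiteness of `S` is imposed
where it is wanted, since a strategy turns a finite MDP into a chain with infinitely many states. -/
structure MarkovChain (O S : Type) where
  init : S
  obs : S → O
  P : S → PMF S

namespace MarkovChain

variable {O S : Type}

/-- The σ-algebra on infinite state sequences that is generated by the cones: the product of the
discrete σ-algebras. -/
abbrev seqSpace (S : Type) : MeasurableSpace (ℕ → S) :=
  @MeasurableSpace.pi ℕ (fun _ => S) (fun _ => ⊤)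

/-- The kernel that samples state number `n + 1` from the states number `0, …, n`. -/
def stepKernel (M : MarkovChain O S) (n : ℕ) :
    @ProbabilityTheory.Kernel ((i : Finset.Iic n) → S) S
      (@MeasurableSpace.pi _ (fun _ => S) (fun _ => ⊤)) ⊤ :=
  letI : MeasurableSpace S := ⊤
  { toFun := fun h => (M.P (h ⟨n, Finset.mem_Iic.2 le_rfl⟩)).toMeasure
    measurable' :=
      (measurable_from_top (f := fun s : S => (M.P s).toMeasure)).comp (measurable_pi_apply _) }

/-- The law of the infinite sequence of states visited by the chain: the sequence starts in the
initial state, and every next state is drawn from the transition distribution of the last one. -/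
def law (M : MarkovChain O S) : @MeasureTheory.Measure (ℕ → S) (seqSpace S) :=
  letI : MeasurableSpace S := ⊤
  haveI : ∀ n, ProbabilityTheory.IsMarkovKernel (M.stepKernel n) := fun n =>
    ⟨fun h => PMF.toMeasure.isProbabilityMeasure (M.P (h ⟨n, Finset.mem_Iic.2 le_rfl⟩))⟩
  ProbabilityTheory.Kernel.traj (X := fun _ => S) M.stepKernel 0 (fun _ => M.init)

/-- The observation associated to an infinite sequence of states. -/
def obsSeq (M : MarkovChain O S) (ρ : ℕ → S) : ℕ → O := fun i => M.obs (ρ i)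

/-- The probability that the observation of a run of the chain belongs to `L`. -/
def prob (M : MarkovChain O S) (L : Set (ℕ → O)) : ENNReal := M.law {ρ | M.obsSeq ρ ∈ L}

end MarkovChain

/-! ### Partially observable Markov decision processes and strategies -/

/-- A Markov decision process with states `S`, observations `O` and actions `A`. -/
structure MDP (O A S : Type) where
  init : S
  obs : S → O
  Δ : S → A → PMF S

/-- A strategy maps `(O × A)* O` to `A`: the first argument is the list of the previous observations
with the actions taken there, the second one is the current observation. -/
abbrev Strategy (O A : Type) := List (O × A) → O → A

/-- The states of the chain that a strategy induces: the finite paths `(S × A)* × S`. -/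
abbrev Hist (S A : Type) := List (S × A) × S

namespace MDP

variable {O A S : Type}

/-- The action that the strategy chooses after the path `π`, of which it sees the observations. -/
def choice (M : MDP O A S) (σ : Strategy O A) (π : Hist S A) : A :=
  σ (π.1.map fun x => (M.obs x.1, x.2)) (M.obs π.2)

/-- The Markov chain induced by a strategy: the path `π` is extended by the action `a` that the
strategy chooses and by a successor drawn from the distribution of `a`. -/
def induced (M : MDP O A S) (σ : Strategy O A) : MarkovChain O (Hist S A) where
  init := ([], M.init)
  obs π := M.obs π.2
  P π := (M.Δ π.2 (M.choice σ π)).map fun s' => (π.1 ++ [(π.2, M.choice σ π)], s')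

end MDP

/-! ### Testing strategies -/

/-- The actions `r` (restart) and `c` (continue). -/
inductive Action
  | r
  | c
  deriving DecidableEq

/-- The restart MDP of a Markov chain. -/
def MarkovChain.restartMDP {O S : Type} (M : MarkovChain O S) : MDP O Action S where
  init := M.init
  obs := M.obs
  Δ s a := match a with
    | .r => PMF.pure M.init
    | .c => M.P s

/-- The steps `t` of a run of the induced chain at which the action is `r`, that is, at which the
path number `t + 1` is obtained from the path number `t` by appending `r` and a state. -/
def restartSteps {S : Type} (ρ : ℕ → Hist S Action) : Set ℕ :=
  {t | ∃ s, (ρ (t + 1)).1.getLast? = some (s, Action.r)}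

/-- The number of restarts. -/
def numRestarts {S : Type} (ρ : ℕ → Hist S Action) : ℕ∞ := (restartSteps ρ).encard

/-- For a run with finitely many restarts, the index of the first path that ends after the last
restart, and `0` if there is no restart. -/
def tailStart {S : Type} (ρ : ℕ → Hist S Action) : ℕ := sSup {t | ∃ u ∈ restartSteps ρ, t = u + 1}

/-- For a run with finitely many restarts, the observations from the last restart on. -/
def MarkovChain.tail {O S : Type} (M : MarkovChain O S) (ρ : ℕ → Hist S Action) : ℕ → O :=
  fun i => M.obs (ρ (tailStart ρ + i)).2

/-- `σ` is a testing strategy for `L` if for every finite Markov chain `M` over the observations `O`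
that gives `L` positive probability, almost every run of the chain that `σ` induces on the restart
MDP of `M` has finitely many restarts and its tail belongs to `L`. -/
def IsTestingStrategy {O : Type} (σ : Strategy O Action) (L : Set (ℕ → O)) : Prop :=
  ∀ (S : Type) [Finite S] (M : MarkovChain O S), 0 < M.prob L →
    ∀ᵐ ρ ∂(M.restartMDP.induced σ).law, numRestarts ρ < ⊤ ∧ M.tail ρ ∈ L

/-! ### Rabin languages -/

/-- The markers `e₁, …, e_k, f₁, …, f_k`. -/
inductive Marker (k : ℕ)
  | e (i : Fin k)
  | f (i : Fin k)

/-- The Rabin language: for some `j`, the marker `e j` occurs infinitely often and the marker `f j`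
only finitely often. -/
def rabin (k : ℕ) : Set (ℕ → Set (Marker k)) :=
  {w | ∃ j, {i | Marker.e j ∈ w i}.Infinite ∧ {i | Marker.f j ∈ w i}.Finite}

/-! ### The strategy

A finite path `s₀ … s_m` is seen by the strategy as the list of its `m + 1` observations. -/

/-- The length `m` (number of steps) of the path `s₀ … s_m`. -/
def pathLength {O : Type} (w : List O) : ℕ := w.length - 1

/-- The second half `s_⌈m/2⌉ … s_m` of `s₀ … s_m`; here `⌈m/2⌉ = (m + 1) / 2`, rounded down. -/
def secondHalf {O : Type} (w : List O) : List O := w.drop ((pathLength w + 1) / 2)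

/-- A path is `i`-good if it has length `0`, or if it contains `e i` but not `f i`. -/
def IsGoodFor {k : ℕ} (i : Fin k) (w : List (Set (Marker k))) : Prop :=
  pathLength w = 0 ∨ ((∃ s ∈ w, Marker.e i ∈ s) ∧ ∀ s ∈ w, Marker.f i ∉ s)

/-- A path is good if it is `i`-good for some `i`. -/
def IsGood {k : ℕ} (w : List (Set (Marker k))) : Prop := ∃ i, IsGoodFor i w

/-- The number of restarts in a history. -/
def restartCount {O : Type} (h : List (O × Action)) : ℕ := (h.map Prod.snd).count Action.r

/-- The path sampled since the last restart: the observations after the last action `r` of the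
history, followed by the current observation. -/
def currentPath {O : Type} (h : List (O × Action)) (o : O) : List O :=
  (h.rtakeWhile fun x => x.2 = Action.c).map Prod.fst ++ [o]

open Classical in
/-- The strategy with parameter `f`.  After the `n`-th restart it samples blocks of `2 * f n` steps.
Whenever a number of complete blocks has been sampled, it restarts if the second half of the path
sampled since the `n`-th restart is not good.  If `f n = 0`, so that there is nothing to sample, it
passes on to the next restart at once. -/
def strategyS (k : ℕ) (f : ℕ → ℕ) : Strategy (Set (Marker k)) Action := fun h o =>
  if f (restartCount h) = 0 ∨
      (2 * f (restartCount h) ∣ pathLength (currentPath h o) ∧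
        ¬ IsGood (secondHalf (currentPath h o)))
  then Action.r else Action.c

end BlackBoxTesting

end

/-!
Fix `E` and `F` in a finite chain. Almost every run reaches a state from which either `E` stays
reachable forever and `F` is unreachable, or `E` is unreachable, or `F` stays reachable forever, and
a set that stays reachable is missed by a window `[t, 2 t]` with probability exponentially small in
`t`. By Borel-Cantelli, almost every run in the Rabin language has good second halves from some
length on, while a run whose complete blocks all have good second halves uses one index `j`
infinitely often and is therefore in the Rabin language.

If `f` is unbounded, each attempt with `f n` large enough is never abandoned with probability at
least some `p > 0`, so that almost surely only finitely many of them fail. If `2 * f n < L` for all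
`n`, a chain that needs `L` steps before it shows its first marker fails its first block in every
attempt and is restarted forever.
-/

namespace BlackBoxTesting

open MeasureTheory ProbabilityTheory Filter Topology
open scoped ENNReal

attribute [local instance] MarkovChain.seqSpace

lemma measure_iInter_eq_of_eventually_eq {α : Type*} {_ : MeasurableSpace α} {μ ν : Measure α}
    [IsFiniteMeasure μ] [IsFiniteMeasure ν] {D : ℕ → Set α} (hD : ∀ n, MeasurableSet (D n))
    (hanti : Antitone D) (h : ∀ᶠ n in atTop, μ (D n) = ν (D n)) :
    μ (⋂ n, D n) = ν (⋂ n, D n) := by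
  have tendsto_measure (η : Measure α) [IsFiniteMeasure η] :
      Tendsto (fun n => η (D n)) atTop (𝓝 (η (⋂ n, D n))) :=
    tendsto_measure_iInter_atTop (fun n => (hD n).nullMeasurableSet) hanti
      ⟨0, measure_ne_top _ _⟩
  exact tendsto_nhds_unique_of_eventuallyEq (tendsto_measure μ) (tendsto_measure ν) h

section PathSpace

variable {S : Type}

/-- The sequence `ρ` with its first `b` terms removed. -/
def shift (b : ℕ) (ρ : ℕ → S) : ℕ → S := fun i => ρ (b + i)

@[simp]
lemma shift_apply (b : ℕ) (ρ : ℕ → S) (i : ℕ) : shift b ρ i = ρ (b + i) := rfl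

lemma measurable_shift (b : ℕ) : Measurable (shift b : (ℕ → S) → ℕ → S) := by
  let _ : MeasurableSpace S := ⊤
  exact measurable_pi_lambda _ fun i => measurable_pi_apply _

lemma measurable_comp_left {S' : Type} (φ : S → S') :
    Measurable (fun ρ : ℕ → S => φ ∘ ρ) := by
  let _ : MeasurableSpace S := ⊤
  let _ : MeasurableSpace S' := ⊤
  exact measurable_pi_lambda _ fun i => measurable_from_top.comp (measurable_pi_apply i)

lemma measurableSet_setOf_coord_mem (n : ℕ) (B : Set S) : MeasurableSet {ρ : ℕ → S | ρ n ∈ B} := by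
  let _ : MeasurableSpace S := ⊤
  exact measurable_pi_apply (X := fun _ : ℕ => S) n (MeasurableSpace.measurableSet_top (s := B))

lemma measurableSet_setOf_frequently_coord_mem (B : Set S) :
    MeasurableSet {ρ : ℕ → S | ∃ᶠ n in atTop, ρ n ∈ B} := by
  simp only [frequently_atTop, Set.ofPred_forall, Set.ofPred_exists, Set.ofPred_and]
  exact MeasurableSet.iInter fun a => MeasurableSet.iUnion fun n =>
    (MeasurableSet.const _).inter (measurableSet_setOf_coord_mem n B)

lemma measurableSet_cylinder (x : ℕ → S) (n : ℕ) :
    MeasurableSet (PiNat.cylinder x n : Set (ℕ → S)) := by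
  have h : (PiNat.cylinder x n : Set (ℕ → S)) = ⋂ i ∈ Set.Iio n, {ρ | ρ i ∈ ({x i} : Set S)} := by
    ext ρ
    simp [PiNat.mem_cylinder_iff]
  rw [h]
  exact MeasurableSet.biInter (Set.to_countable _) fun i _ => measurableSet_setOf_coord_mem i _

lemma dependsOn_coord_mem (n : ℕ) (B : Set S) :
    DependsOn (· ∈ {ρ : ℕ → S | ρ n ∈ B}) (Set.Iic n) := fun ρ ρ' h => by
  simp [h n Set.self_mem_Iic]

lemma dependsOn_mem_cylinder (x : ℕ → S) (n : ℕ) :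
    DependsOn (· ∈ (PiNat.cylinder x (n + 1) : Set (ℕ → S))) (Set.Iic n) := fun ρ ρ' h => by
  simp only [PiNat.mem_cylinder_iff, Nat.lt_succ_iff]
  exact propext (forall₂_congr fun i hi => by rw [h i hi])

lemma dependsOn_forall_le (n : ℕ) (p : ℕ → S → Prop) :
    DependsOn (· ∈ {ρ : ℕ → S | ∀ i ≤ n, p i (ρ i)}) (Set.Iic n) := fun ρ ρ' h => by
  exact propext (forall₂_congr fun i hi => by rw [h i hi])

lemma dependsOn_mem_inter {T : Set ℕ} {A B : Set (ℕ → S)} (hA : DependsOn (· ∈ A) T)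
    (hB : DependsOn (· ∈ B) T) : DependsOn (· ∈ A ∩ B) T := fun _ _ h =>
  congrArg₂ And (hA h) (hB h)

lemma preimage_frestrictLe_image {n : ℕ} {A : Set (ℕ → S)} (hA : DependsOn (· ∈ A) (Set.Iic n)) :
    Preorder.frestrictLe (π := fun _ => S) n ⁻¹' (Preorder.frestrictLe n '' A) = A := by
  refine Set.Subset.antisymm ?_ (Set.subset_preimage_image _ _)
  rintro ρ ⟨x, hx, h⟩
  exact (hA fun i hi => congrFun h ⟨i, Finset.mem_Iic.2 hi⟩).mp hx

lemma preimage_frestrictLe_singleton (n : ℕ) (x : ℕ → S) :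
    Preorder.frestrictLe (π := fun _ => S) n ⁻¹' {Preorder.frestrictLe n x} =
      PiNat.cylinder x (n + 1) := by
  ext ρ
  simp [PiNat.mem_cylinder_iff, funext_iff, Preorder.frestrictLe]

lemma exists_dependsOn_of_mem_measurableCylinders {A : Set (ℕ → S)}
    (hA : A ∈ @measurableCylinders ℕ (fun _ => S) fun _ => ⊤) :
    ∃ n, DependsOn (· ∈ A) (Set.Iic n) := by
  let _ : MeasurableSpace S := ⊤
  obtain ⟨s, T, -, rfl⟩ := (mem_measurableCylinders A).1 hA
  refine ⟨s.sup id, fun ρ ρ' h => ?_⟩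
  have hr : s.restrict ρ = s.restrict ρ' := funext fun i => h i (Finset.le_sup (f := id) i.2)
  simp only [mem_cylinder, hr]

variable [Countable S]

lemma measurableSet_of_dependsOn {n : ℕ} {A : Set (ℕ → S)} (hA : DependsOn (· ∈ A) (Set.Iic n)) :
    MeasurableSet A := by
  let _ : MeasurableSpace S := ⊤
  rw [← preimage_frestrictLe_image hA]
  exact Preorder.measurable_frestrictLe n (Set.to_countable _).measurableSet

lemma measure_eq_tsum_coord (μ : Measure (ℕ → S)) (b : ℕ) {A : Set (ℕ → S)}
    (hA : MeasurableSet A) : μ A = ∑' s, μ (A ∩ {ρ | ρ b ∈ ({s} : Set S)}) := by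
  have hdisj : Pairwise (Function.onFun Disjoint fun s => A ∩ {ρ | ρ b ∈ ({s} : Set S)}) :=
    (pairwise_disjoint_fiber fun ρ : ℕ → S => ρ b).mono fun s t h =>
      h.mono Set.inter_subset_right Set.inter_subset_right
  rw [← measure_iUnion hdisj fun s => hA.inter (measurableSet_setOf_coord_mem b {s}),
    ← Set.inter_iUnion, Set.inter_eq_left.2 fun ρ _ => Set.mem_iUnion.2 ⟨ρ b, rfl⟩]

lemma measure_eq_of_dependsOn {μ ν : Measure (ℕ → S)} {n : ℕ} {A : Set (ℕ → S)}
    (hA : DependsOn (· ∈ A) (Set.Iic n))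
    (h : ∀ x ∈ A, μ (PiNat.cylinder x (n + 1)) = ν (PiNat.cylinder x (n + 1))) : μ A = ν A := by
  have sum_cylinders (η : Measure (ℕ → S)) :
      η A = ∑' y : Preorder.frestrictLe (π := fun _ => S) n '' A,
        η (Preorder.frestrictLe (π := fun _ => S) n ⁻¹' {y.1}) := by
    rw [tsum_measure_preimage_singleton (Set.to_countable _), preimage_frestrictLe_image hA]
    rintro _ ⟨x, -, rfl⟩
    rw [preimage_frestrictLe_singleton]
    exact measurableSet_cylinder x (n + 1)
  rw [sum_cylinders μ, sum_cylinders ν]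
  refine tsum_congr ?_
  rintro ⟨_, x, hx, rfl⟩
  simpa only [preimage_frestrictLe_singleton] using h x hx

lemma measure_restrict_iInter_eq_of_dependsOn {μ ν : Measure (ℕ → S)} [IsFiniteMeasure μ]
    [IsFiniteMeasure ν] {D : ℕ → Set (ℕ → S)} (hD : ∀ n, DependsOn (· ∈ D n) (Set.Iic n))
    (hanti : Antitone D)
    (h : ∀ n, ∀ x ∈ D n, μ (PiNat.cylinder x (n + 1)) = ν (PiNat.cylinder x (n + 1))) :
    μ.restrict (⋂ n, D n) = ν.restrict (⋂ n, D n) := by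
  have restrict_eq (m : ℕ) (A : Set (ℕ → S)) (hA : DependsOn (· ∈ A) (Set.Iic m)) :
      μ.restrict (⋂ n, D n) A = ν.restrict (⋂ n, D n) A := by
    have hAm := measurableSet_of_dependsOn hA
    rw [Measure.restrict_apply hAm, Measure.restrict_apply hAm, Set.inter_iInter]
    refine measure_iInter_eq_of_eventually_eq
      (fun n => hAm.inter (measurableSet_of_dependsOn (hD n)))
      (fun i j hij => Set.inter_subset_inter_right _ (hanti hij)) ?_
    filter_upwards [eventually_ge_atTop m] with n hn
    exact measure_eq_of_dependsOn
      (dependsOn_mem_inter (hA.mono (Set.Iic_subset_Iic.2 hn)) (hD n)) fun x hx => h n x hx.2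
  let _ : MeasurableSpace S := ⊤
  refine ext_of_generate_finite _ generateFrom_measurableCylinders.symm
    isPiSystem_measurableCylinders (fun A hA => ?_)
    (restrict_eq 0 Set.univ ((dependsOn_const True).mono (Set.empty_subset _)))
  obtain ⟨m, hm⟩ := exists_dependsOn_of_mem_measurableCylinders hA
  exact restrict_eq m A hm

lemma measure_ext_of_cylinder {μ ν : Measure (ℕ → S)} [IsFiniteMeasure μ] [IsFiniteMeasure ν]
    (h : ∀ n x, μ (PiNat.cylinder x (n + 1)) = ν (PiNat.cylinder x (n + 1))) : μ = ν := by
  simpa only [Set.iInter_const, Measure.restrict_univ] using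
    measure_restrict_iInter_eq_of_dependsOn (D := fun _ => Set.univ)
      (fun _ => (dependsOn_const True).mono (Set.empty_subset _)) antitone_const
      fun n x _ => h n x

end PathSpace

namespace MarkovChain

variable {O S : Type} (M : MarkovChain O S)

/-- The chain `M` with initial state `s`. -/
def startAt (s : S) : MarkovChain O S := { M with init := s }

@[simp] lemma startAt_init (s : S) : (M.startAt s).init = s := rfl

@[simp] lemma startAt_P (s : S) : (M.startAt s).P = M.P := rfl

/-- Every step of `ρ` is a transition of `M` of positive probability. -/
def IsPath (ρ : ℕ → S) : Prop := ∀ n, ρ (n + 1) ∈ (M.P (ρ n)).support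

lemma measurable_obsSeq : Measurable M.obsSeq := measurable_comp_left M.obs

lemma isMarkovKernel_stepKernel (n : ℕ) :
    @IsMarkovKernel _ _ (@MeasurableSpace.pi _ _ fun _ => ⊤) ⊤ (M.stepKernel n) :=
  let _ : MeasurableSpace S := ⊤
  ⟨fun h => PMF.toMeasure.isProbabilityMeasure (M.P (h ⟨n, Finset.mem_Iic.2 le_rfl⟩))⟩

instance : IsProbabilityMeasure M.law := by
  let _ : MeasurableSpace S := ⊤
  have := M.isMarkovKernel_stepKernel
  unfold law
  infer_instance

lemma ae_init : ∀ᵐ ρ ∂M.law, ρ 0 = M.init := by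
  let _ : MeasurableSpace S := ⊤
  have := M.isMarkovKernel_stepKernel
  have hmap : M.law.map (Preorder.frestrictLe 0) = Measure.dirac fun _ => M.init := by
    rw [law, Kernel.traj_map_frestrictLe_apply, Kernel.partialTraj_self, Kernel.id_apply]
  have h0 : Measurable fun y : (Finset.Iic 0 : Finset ℕ) → S => y ⟨0, Finset.mem_Iic.2 le_rfl⟩ :=
    measurable_pi_apply _
  refine ae_of_ae_map (f := Preorder.frestrictLe (π := fun _ => S) 0)
    (p := fun y => y ⟨0, Finset.mem_Iic.2 le_rfl⟩ = M.init)
    (Preorder.measurable_frestrictLe 0).aemeasurable ?_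
  rw [hmap]
  exact (ae_dirac_iff (h0 (MeasurableSpace.measurableSet_top (s := {M.init})))).2 rfl

open Classical in
lemma law_cylinder_one (x : ℕ → S) :
    M.law (PiNat.cylinder x 1) = if x 0 = M.init then 1 else 0 := by
  have hmem (ρ : ℕ → S) : ρ ∈ PiNat.cylinder x 1 ↔ ρ 0 = x 0 := by
    simp [PiNat.mem_cylinder_iff]
  split_ifs with h
  · refine (mem_ae_iff_prob_eq_one (measurableSet_cylinder x 1)).1 ?_
    filter_upwards [M.ae_init] with ρ h0
    exact (hmem ρ).2 (h0.trans h.symm)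
  · rw [measure_eq_zero_iff_ae_notMem]
    filter_upwards [M.ae_init] with ρ h0 hρ
    exact h (((hmem ρ).1 hρ).symm.trans h0)

variable [Countable S]

lemma law_inter_succ {n : ℕ} {A : Set (ℕ → S)} (hA : DependsOn (· ∈ A) (Set.Iic n)) (B : Set S)
    (c : ℝ≥0∞) (hc : ∀ ρ ∈ A, (M.P (ρ n)).toOuterMeasure B = c) :
    M.law (A ∩ {ρ | ρ (n + 1) ∈ B}) = M.law A * c := by
  let _ : MeasurableSpace S := ⊤
  have := M.isMarkovKernel_stepKernel
  let past : (ℕ → S) → (Finset.Iic n → S) := Preorder.frestrictLe (π := fun _ => S) n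
  have hpast : Measurable past := Preorder.measurable_frestrictLe n
  have hA' : MeasurableSet (past '' A) := (Set.to_countable _).measurableSet
  have hB : MeasurableSet B := MeasurableSpace.measurableSet_top
  have hcomp : M.law.map past ⊗ₘ M.stepKernel n = M.law.map fun ρ => (past ρ, ρ (n + 1)) := by
    rw [law, Kernel.traj_map_frestrictLe_apply]
    exact Kernel.partialTraj_compProd_eq_map_traj (Nat.zero_le n)
  have hpre : past ⁻¹' (past '' A) = A := preimage_frestrictLe_image hA
  calc M.law (A ∩ {ρ | ρ (n + 1) ∈ B})
      = (M.law.map past ⊗ₘ M.stepKernel n) ((past '' A) ×ˢ B) := by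
        rw [hcomp, Measure.map_apply (hpast.prodMk (measurable_pi_apply _)) (hA'.prod hB),
          Set.mk_preimage_prod, hpre]
        rfl
    _ = ∫⁻ y in past '' A, M.stepKernel n y B ∂M.law.map past :=
        Measure.compProd_apply_prod hA' hB
    _ = ∫⁻ _ in past '' A, c ∂M.law.map past := by
        refine setLIntegral_congr_fun hA' ?_
        rintro _ ⟨ρ, hρ, rfl⟩
        exact (PMF.toMeasure_apply_eq_toOuterMeasure_apply _ hB).trans (hc ρ hρ)
    _ = M.law A * c := by
        rw [setLIntegral_const, Measure.map_apply hpast hA', hpre, mul_comm]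

lemma ae_isPath : ∀ᵐ ρ ∂M.law, M.IsPath ρ := by
  refine ae_all_iff.2 fun n => ?_
  have transition (s : S) : ∀ᵐ ρ ∂M.law, ρ n = s → ρ (n + 1) ∈ (M.P s).support := by
    have h := M.law_inter_succ (dependsOn_coord_mem n {s}) (M.P s).supportᶜ 0 (by
      rintro ρ rfl
      rw [PMF.toOuterMeasure_apply_eq_zero_iff]
      exact disjoint_compl_right)
    rw [mul_zero] at h
    exact measure_mono_null (fun ρ hρ => by simpa using hρ) h
  filter_upwards [ae_all_iff.2 transition] with ρ hρ
  exact hρ _ rfl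

lemma law_inter_shift_cylinder_succ {b : ℕ} {A : Set (ℕ → S)}
    (hA : DependsOn (· ∈ A) (Set.Iic b)) (x : ℕ → S) (n : ℕ) :
    M.law (A ∩ shift b ⁻¹' PiNat.cylinder x (n + 2)) =
      M.law (A ∩ shift b ⁻¹' PiNat.cylinder x (n + 1)) * M.P (x n) (x (n + 1)) := by
  have hd : DependsOn (· ∈ A ∩ shift b ⁻¹' PiNat.cylinder x (n + 1)) (Set.Iic (b + n)) :=
    dependsOn_mem_inter (hA.mono (Set.Iic_subset_Iic.2 (Nat.le_add_right _ _)))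
      fun ρ ρ' h => dependsOn_mem_cylinder x n fun i hi =>
        h (b + i) (Nat.add_le_add_left (Set.mem_Iic.1 hi) b)
  rw [← M.law_inter_succ hd {x (n + 1)} _ fun ρ hρ => by
    rw [PMF.toOuterMeasure_apply_singleton, ← PiNat.mem_cylinder_iff.1 hρ.2 n n.lt_succ_self,
      shift_apply]]
  congr 1
  ext ρ
  simp only [Set.mem_inter_iff, Set.mem_preimage, PiNat.mem_cylinder_iff,
    Nat.forall_lt_succ_right (n := n + 1), shift_apply, Set.mem_ofPred_eq, Set.mem_singleton_iff,
    and_assoc, add_assoc]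

lemma law_cylinder_succ (x : ℕ → S) (n : ℕ) :
    M.law (PiNat.cylinder x (n + 2)) =
      M.law (PiNat.cylinder x (n + 1)) * M.P (x n) (x (n + 1)) := by
  have hshift : (shift 0 : (ℕ → S) → ℕ → S) = id := by
    ext ρ i
    simp
  simpa only [hshift, Set.preimage_id, Set.univ_inter] using
    M.law_inter_shift_cylinder_succ (b := 0) (A := Set.univ)
      ((dependsOn_const True).mono (Set.empty_subset _)) x n

lemma law_inter_shift_cylinder {b : ℕ} {A : Set (ℕ → S)} (hA : DependsOn (· ∈ A) (Set.Iic b))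
    {s : S} (hs : ∀ ρ ∈ A, ρ b = s) (x : ℕ → S) (n : ℕ) :
    M.law (A ∩ shift b ⁻¹' PiNat.cylinder x (n + 1)) =
      M.law A * (M.startAt s).law (PiNat.cylinder x (n + 1)) := by
  induction n with
  | zero =>
    have hmem (ρ : ℕ → S) (hρ : ρ ∈ A) : ρ ∈ shift b ⁻¹' PiNat.cylinder x 1 ↔ x 0 = s := by
      simp [PiNat.mem_cylinder_iff, hs ρ hρ, eq_comm]
    rw [zero_add, law_cylinder_one, startAt_init]
    split_ifs with h
    · rw [mul_one, Set.inter_eq_left.2 fun ρ hρ => (hmem ρ hρ).2 h]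
    · rw [mul_zero, Set.disjoint_iff_inter_eq_empty.1 (Set.disjoint_left.2 fun ρ hρ hρ' =>
        h ((hmem ρ hρ).1 hρ')), measure_empty]
  | succ n ih =>
    rw [law_inter_shift_cylinder_succ M hA, law_cylinder_succ, ih, startAt_P, mul_assoc]

lemma law_inter_shift {b : ℕ} {A : Set (ℕ → S)} (hA : DependsOn (· ∈ A) (Set.Iic b)) {s : S}
    (hs : ∀ ρ ∈ A, ρ b = s) {E : Set (ℕ → S)} (hE : MeasurableSet E) :
    M.law (A ∩ shift b ⁻¹' E) = M.law A * (M.startAt s).law E := by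
  have map_apply {B : Set (ℕ → S)} (hB : MeasurableSet B) :
      (M.law.restrict A).map (shift b) B = M.law (A ∩ shift b ⁻¹' B) := by
    rw [Measure.map_apply (measurable_shift b) hB,
      Measure.restrict_apply (measurable_shift b hB), Set.inter_comm]
  have : IsFiniteMeasure (M.law A • (M.startAt s).law) :=
    Measure.smul_finite _ (measure_ne_top _ _)
  have heq : (M.law.restrict A).map (shift b) = M.law A • (M.startAt s).law :=
    measure_ext_of_cylinder fun n x => by
      rw [map_apply (measurableSet_cylinder x _), M.law_inter_shift_cylinder hA hs]
      rfl
  rw [← map_apply hE, heq]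
  rfl

lemma law_inter_shift_le {b : ℕ} {A : Set (ℕ → S)} (hA : DependsOn (· ∈ A) (Set.Iic b)) {C : Set S}
    (hC : ∀ ρ ∈ A, ρ b ∈ C) {E : Set (ℕ → S)} (hE : MeasurableSet E) {c : ℝ≥0∞}
    (hc : ∀ s ∈ C, (M.startAt s).law E ≤ c) :
    M.law (A ∩ shift b ⁻¹' E) ≤ c * M.law A := by
  have hAm := measurableSet_of_dependsOn hA
  rw [measure_eq_tsum_coord _ b (hAm.inter (measurable_shift b hE)),
    measure_eq_tsum_coord _ b hAm, ← ENNReal.tsum_mul_left]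
  refine ENNReal.tsum_le_tsum fun s => ?_
  rw [Set.inter_right_comm, M.law_inter_shift (dependsOn_mem_inter hA (dependsOn_coord_mem b {s}))
    (fun ρ hρ => hρ.2) hE, mul_comm]
  obtain h | ⟨ρ, hρ, rfl⟩ := (A ∩ {ρ | ρ b ∈ ({s} : Set S)}).eq_empty_or_nonempty
  · simp only [h, measure_empty, mul_zero, le_refl]
  · gcongr
    exact hc _ (hC ρ hρ)

end MarkovChain

lemma tsum_pow_div_ne_top {a : ℝ≥0∞} (ha : a < 1) {d : ℕ} (hd : 0 < d) :
    ∑' t, a ^ (t / d) ≠ ∞ := by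
  have : NeZero d := ⟨hd.ne'⟩
  rw [← (Nat.divModEquiv d).symm.tsum_eq, ENNReal.tsum_prod']
  have hdiv (m : ℕ) (r : Fin d) : (Nat.divModEquiv d).symm (m, r) / d = m :=
    congrArg Prod.fst ((Nat.divModEquiv d).apply_symm_apply (m, r))
  simp only [hdiv, tsum_fintype, Finset.sum_const, nsmul_eq_mul, ENNReal.tsum_mul_left,
    ENNReal.tsum_geometric]
  exact ENNReal.mul_ne_top (ENNReal.natCast_ne_top _) (ENNReal.inv_ne_top.2 (tsub_pos_of_lt ha).ne')

/-- `p` holds somewhere in the window `[t, 2 t]`, for all but finitely many `t`. -/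
def HitsWindows (p : ℕ → Prop) : Prop := ∀ᶠ t in atTop, ∃ i ∈ Set.Icc t (2 * t), p i

lemma HitsWindows.frequently {p : ℕ → Prop} (h : HitsWindows p) : ∃ᶠ i in atTop, p i := by
  refine frequently_atTop.2 fun a => ?_
  obtain ⟨t, ⟨i, hi, hp⟩, hat⟩ := (h.and (eventually_ge_atTop a)).exists
  exact ⟨i, hat.trans hi.1, hp⟩

namespace MarkovChain

variable {O S : Type} (M : MarkovChain O S)

/-- The state `t` can be reached from the state `s`. -/
def Reach (s t : S) : Prop := Relation.ReflTransGen (fun s t => t ∈ (M.P s).support) s t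

/-- The states from which some state of `T` can be reached. -/
def canReach (T : Set S) : Set S := {s | ∃ t ∈ T, M.Reach s t}

/-- The states from which only states of `A` can be reached. -/
def always (A : Set S) : Set S := {s | ∀ t, M.Reach s t → t ∈ A}

/-- `C` cannot be left. -/
def IsAbsorbing (C : Set S) : Prop := ∀ s ∈ C, ∀ t ∈ (M.P s).support, t ∈ C

variable {M}

lemma isAbsorbing_always (A : Set S) : M.IsAbsorbing (M.always A) :=
  fun _ hs _ ht _ htu => hs _ (.head ht htu)

lemma isAbsorbing_univ : M.IsAbsorbing Set.univ := fun _ _ t _ => Set.mem_univ t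

lemma always_subset (A : Set S) : M.always A ⊆ A := fun s hs => hs s .refl

lemma IsAbsorbing.mem_of_le {C : Set S} (hC : M.IsAbsorbing C) {ρ : ℕ → S} (hρ : M.IsPath ρ)
    {m n : ℕ} (hmn : m ≤ n) (hm : ρ m ∈ C) : ρ n ∈ C := by
  induction n, hmn using Nat.le_induction with
  | base => exact hm
  | succ n _ ih => exact hC _ ih _ (hρ n)

lemma canReach_always_or (E F : Set S) (s : S) :
    s ∈ M.canReach (M.always (M.canReach E) ∩ M.always Fᶜ ∪ M.always Eᶜ ∪
      M.always (M.canReach F)) := by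
  have not_canReach (A : Set S) (t : S) (ht : t ∉ M.canReach A) : t ∈ M.always Aᶜ :=
    fun u htu hu => ht ⟨u, hu, htu⟩
  have exists_of_notMem (A : Set S) (t : S) (ht : t ∉ M.always (M.canReach A)) :
      ∃ u ∈ M.always Aᶜ, M.Reach t u := by
    simp only [always, Set.mem_ofPred_eq, not_forall] at ht
    obtain ⟨u, htu, hu⟩ := ht
    exact ⟨u, not_canReach A u hu, htu⟩
  by_cases hF : s ∈ M.always (M.canReach F)
  · exact ⟨s, .inr hF, .refl⟩
  obtain ⟨t, ht, hst⟩ := exists_of_notMem F s hF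
  by_cases hE : t ∈ M.always (M.canReach E)
  · exact ⟨t, .inl (.inl ⟨hE, ht⟩), hst⟩
  obtain ⟨u, hu, htu⟩ := exists_of_notMem E t hE
  exact ⟨u, .inl (.inr hu), hst.trans htu⟩

section Countable

variable [Countable S]

lemma Reach.exists_law_coord_pos {s t : S} (h : M.Reach s t) :
    ∃ n, 0 < (M.startAt s).law {ρ | ρ n ∈ ({t} : Set S)} := by
  induction h with
  | refl =>
    refine ⟨0, ?_⟩
    have h0 : (M.startAt s).law {ρ | ρ 0 ∈ ({s} : Set S)} = 1 :=
      (mem_ae_iff_prob_eq_one (measurableSet_setOf_coord_mem 0 {s})).1 (M.startAt s).ae_init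
    rw [h0]
    exact one_pos
  | @tail u v _ huv ih =>
    obtain ⟨n, hn⟩ := ih
    have hstep := (M.startAt s).law_inter_succ (dependsOn_coord_mem n {u}) {v} (M.P u v)
      (by rintro ρ rfl; exact PMF.toOuterMeasure_apply_singleton _ _)
    have hpos := ENNReal.mul_pos hn.ne' ((PMF.mem_support_iff _ _).1 huv)
    exact ⟨n + 1, hpos.trans_le (hstep.ge.trans (measure_mono Set.inter_subset_right))⟩

lemma eventually_law_forall_notMem_lt_one {T : Set S} {s : S} (hs : s ∈ M.canReach T) :
    ∀ᶠ n in atTop, (M.startAt s).law {ρ | ∀ i ≤ n, ρ i ∉ T} < 1 := by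
  obtain ⟨t, ht, hst⟩ := hs
  obtain ⟨m, hm⟩ := hst.exists_law_coord_pos
  filter_upwards [eventually_ge_atTop m] with n hn
  calc (M.startAt s).law {ρ | ∀ i ≤ n, ρ i ∉ T}
      ≤ (M.startAt s).law {ρ | ρ m ∈ ({t} : Set S)}ᶜ :=
        measure_mono fun ρ hρ hρm => hρ m hn (Set.mem_singleton_iff.1 hρm ▸ ht)
    _ = 1 - (M.startAt s).law {ρ | ρ m ∈ ({t} : Set S)} :=
        prob_compl_eq_one_sub (measurableSet_setOf_coord_mem m {t})
    _ < 1 := ENNReal.sub_lt_self ENNReal.one_ne_top one_ne_zero hm.ne'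

end Countable

lemma exists_law_forall_notMem_le [Finite S] {C T : Set S} (hCT : C ⊆ M.canReach T) :
    ∃ d, 0 < d ∧ ∃ a < 1, ∀ s ∈ C, (M.startAt s).law {ρ | ∀ i ≤ d, ρ i ∉ T} ≤ a := by
  have hd : ∀ᶠ d in atTop, ∀ s ∈ C, (M.startAt s).law {ρ | ∀ i ≤ d, ρ i ∉ T} < 1 :=
    C.toFinite.eventually_all.2 fun s hs => eventually_law_forall_notMem_lt_one (hCT hs)
  obtain ⟨d, hd, hd0⟩ := (hd.and (eventually_gt_atTop 0)).exists
  have ha : ∀ᶠ a in 𝓝[<] (1 : ℝ≥0∞), ∀ s ∈ C,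
      (M.startAt s).law {ρ | ∀ i ≤ d, ρ i ∉ T} ≤ a :=
    C.toFinite.eventually_all.2 fun s hs =>
      mem_of_superset (Ioo_mem_nhdsLT (hd s hs)) fun a ha => ha.1.le
  obtain ⟨a, ha, ha1⟩ := (ha.and self_mem_nhdsWithin).exists
  exact ⟨d, hd0, a, ha1, ha⟩

lemma law_forall_notMem_le_pow [Countable S] {C T : Set S} (hC : M.IsAbsorbing C) {d : ℕ} {a : ℝ≥0∞}
    (ha : ∀ s ∈ C, (M.startAt s).law {ρ | ∀ i ≤ d, ρ i ∉ T} ≤ a) (m : ℕ) {s : S} (hs : s ∈ C) :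
    (M.startAt s).law {ρ | ∀ i ≤ d * m, ρ i ∉ T} ≤ a ^ m := by
  have dependsOn_avoid (n : ℕ) :
      DependsOn (· ∈ {ρ : ℕ → S | ∀ i ≤ n, ρ i ∉ T}) (Set.Iic n) :=
    dependsOn_forall_le n fun _ s => s ∉ T
  induction m with
  | zero => simpa only [pow_zero] using prob_le_one
  | succ m ih =>
    have hle : (M.startAt s).law {ρ | ∀ i ≤ d * (m + 1), ρ i ∉ T} ≤ (M.startAt s).law
        (({ρ | ∀ i ≤ d * m, ρ i ∉ T} ∩ {ρ | ρ (d * m) ∈ C}) ∩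
          shift (d * m) ⁻¹' {ρ | ∀ i ≤ d, ρ i ∉ T}) := by
      refine measure_mono_ae ?_
      filter_upwards [(M.startAt s).ae_init, (M.startAt s).ae_isPath] with ρ h0 hρ havoid
      exact ⟨⟨fun i hi => havoid i (by rw [mul_add]; lia),
        hC.mem_of_le hρ (Nat.zero_le _) (h0 ▸ hs)⟩, fun i hi => havoid _ (by rw [mul_add]; lia)⟩
    calc (M.startAt s).law {ρ | ∀ i ≤ d * (m + 1), ρ i ∉ T}
        ≤ a * (M.startAt s).law ({ρ | ∀ i ≤ d * m, ρ i ∉ T} ∩ {ρ | ρ (d * m) ∈ C}) :=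
          hle.trans <| (M.startAt s).law_inter_shift_le
            (dependsOn_mem_inter (dependsOn_avoid _) (dependsOn_coord_mem _ C))
            (fun ρ hρ => hρ.2) (measurableSet_of_dependsOn (dependsOn_avoid d)) ha
      _ ≤ a * a ^ m := by
          gcongr
          exact (measure_mono Set.inter_subset_left).trans ih
      _ = a ^ (m + 1) := (pow_succ' a m).symm

variable (M)

lemma ae_hitsWindows [Finite S] {C T : Set S} (hC : M.IsAbsorbing C) (hCT : C ⊆ M.canReach T) :
    ∀ᵐ ρ ∂M.law, (∃ n, ρ n ∈ C) → HitsWindows (ρ · ∈ T) := by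
  obtain ⟨d, hd, a, ha1, ha⟩ := exists_law_forall_notMem_le hCT
  let missed (t : ℕ) : Set (ℕ → S) := {ρ | ρ t ∈ C ∧ ∀ i ∈ Set.Icc t (2 * t), ρ i ∉ T}
  have law_missed (t : ℕ) : M.law (missed t) ≤ a ^ (t / d) := by
    have hle := M.law_inter_shift_le (b := t) (dependsOn_coord_mem t C) (fun ρ hρ => hρ)
      (measurableSet_of_dependsOn (dependsOn_forall_le (d * (t / d)) fun _ s => s ∉ T))
      fun s hs => law_forall_notMem_le_pow hC ha (t / d) hs
    have hdt : d * (t / d) ≤ t := Nat.mul_div_le t d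
    refine (measure_mono fun ρ hρ => ?_).trans (hle.trans (mul_le_of_le_one_right' prob_le_one))
    exact ⟨hρ.1, fun i hi => hρ.2 _ ⟨by lia, by lia⟩⟩
  have summable : ∑' t, M.law (missed t) ≠ ∞ :=
    ne_top_of_le_ne_top (tsum_pow_div_ne_top ha1 hd) (ENNReal.tsum_le_tsum law_missed)
  filter_upwards [ae_eventually_notMem summable, M.ae_isPath] with ρ hmissed hρ ⟨n, hn⟩
  filter_upwards [hmissed, eventually_ge_atTop n] with t ht hnt
  by_contra! h
  exact ht ⟨hC.mem_of_le hρ hnt hn, h⟩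

lemma ae_trichotomy [Finite S] (E F : Set S) :
    ∀ᵐ ρ ∂M.law, (HitsWindows (ρ · ∈ E) ∧ ∀ᶠ i in atTop, ρ i ∉ F) ∨
      (∀ᶠ i in atTop, ρ i ∉ E) ∨ HitsWindows (ρ · ∈ F) := by
  have never {A : Set S} {ρ : ℕ → S} (hρ : M.IsPath ρ) {n : ℕ} (hn : ρ n ∈ M.always Aᶜ) :
      ∀ᶠ i in atTop, ρ i ∉ A := by
    filter_upwards [eventually_ge_atTop n] with i hi
    exact always_subset Aᶜ ((isAbsorbing_always _).mem_of_le hρ hi hn)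
  filter_upwards [M.ae_isPath,
    M.ae_hitsWindows isAbsorbing_univ fun s _ => canReach_always_or E F s,
    M.ae_hitsWindows (isAbsorbing_always _) (always_subset (M.canReach E)),
    M.ae_hitsWindows (isAbsorbing_always _) (always_subset (M.canReach F))] with
    ρ hρ hsettle hE hF
  obtain ⟨n, (⟨hnE, hnF⟩ | hn) | hn⟩ := (hsettle ⟨0, Set.mem_univ _⟩).frequently.exists
  · exact .inl ⟨hE ⟨n, hnE⟩, never hρ hnF⟩
  · exact .inr (.inl (never hρ hn))
  · exact .inr (.inr (hF ⟨n, hn⟩))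

variable [Countable S]

lemma law_le_mul_law_exists_mem (R : Set S) {E : Set (ℕ → S)} (hE : MeasurableSet E)
    (hshift : ∀ ρ ∈ E, ∀ b, shift b ρ ∈ E) (hvisit : ∀ ρ ∈ E, ∃ t, ρ (t + 1) ∈ R)
    {q : ℝ≥0∞} (hq : ∀ s ∈ R, (M.startAt s).law E ≤ q) :
    M.law E ≤ q * M.law {ρ | ∃ t, ρ (t + 1) ∈ R} := by
  let visit (t : ℕ) : Set (ℕ → S) := {ρ | ρ (t + 1) ∈ R}
  have dependsOn_firstVisit (t : ℕ) : DependsOn (· ∈ disjointed visit t) (Set.Iic (t + 1)) := by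
    intro ρ ρ' h
    have hiff (u : ℕ) (hu : u ≤ t) : ρ ∈ visit u ↔ ρ' ∈ visit u := by
      simp only [visit, Set.mem_ofPred_eq, h (u + 1) (Nat.succ_le_succ hu)]
    simp only [disjointed_eq_inter_compl, Set.mem_inter_iff, Set.mem_iInter, Set.mem_compl_iff]
    exact propext (and_congr (hiff t le_rfl) (forall₂_congr fun u hu => not_congr (hiff u hu.le)))
  have hunion : {ρ : ℕ → S | ∃ t, ρ (t + 1) ∈ R} = ⋃ t, disjointed visit t := by
    rw [iUnion_disjointed]
    exact Set.ofPred_exists _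
  calc M.law E ≤ M.law (⋃ t, disjointed visit t ∩ shift (t + 1) ⁻¹' E) := by
        refine measure_mono fun ρ hρ => ?_
        obtain ⟨t, ht⟩ := Set.mem_iUnion.1 (hunion.subset (hvisit ρ hρ))
        exact Set.mem_iUnion.2 ⟨t, ht, hshift ρ hρ _⟩
    _ ≤ ∑' t, M.law (disjointed visit t ∩ shift (t + 1) ⁻¹' E) := measure_iUnion_le _
    _ ≤ ∑' t, q * M.law (disjointed visit t) := ENNReal.tsum_le_tsum fun t =>
        M.law_inter_shift_le (dependsOn_firstVisit t)
          (fun ρ hρ => disjointed_subset visit t hρ) hE hq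
    _ = q * M.law {ρ | ∃ t, ρ (t + 1) ∈ R} := by
        rw [ENNReal.tsum_mul_left, hunion, measure_iUnion (disjoint_disjointed visit)
          fun t => measurableSet_of_dependsOn (dependsOn_firstVisit t)]

lemma ae_not_frequently_mem {R : Set S} {a : ℝ≥0∞} (ha : a < 1)
    (hR : ∀ s ∈ R, (M.startAt s).law {ρ | ∃ t, ρ (t + 1) ∈ R} ≤ a) :
    ∀ᵐ ρ ∂M.law, ¬ ∃ᶠ t in atTop, ρ t ∈ R := by
  let E : Set (ℕ → S) := {ρ | ∃ᶠ t in atTop, ρ t ∈ R}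
  have hE : MeasurableSet E := measurableSet_setOf_frequently_coord_mem R
  have hshift (ρ : ℕ → S) (hρ : ρ ∈ E) (b : ℕ) : shift b ρ ∈ E := by
    refine frequently_atTop.2 fun a => ?_
    obtain ⟨t, ht, hmem⟩ := frequently_atTop.1 hρ (b + a)
    obtain ⟨u, rfl⟩ := Nat.exists_eq_add_of_le ht
    exact ⟨a + u, Nat.le_add_right a u, by rwa [shift_apply, ← add_assoc]⟩
  have hvisit (ρ : ℕ → S) (hρ : ρ ∈ E) : ∃ t, ρ (t + 1) ∈ R := by
    obtain ⟨t, ht, hmem⟩ := frequently_atTop.1 hρ 1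
    exact ⟨t - 1, by rwa [Nat.sub_add_cancel ht]⟩
  let q := ⨆ s ∈ R, (M.startAt s).law E
  have hq (s : S) (hs : s ∈ R) : (M.startAt s).law E ≤ q :=
    le_iSup₂ (f := fun s (_ : s ∈ R) => (M.startAt s).law E) s hs
  have hqa : q ≤ q * a := iSup₂_le fun s hs =>
    ((M.startAt s).law_le_mul_law_exists_mem R hE hshift hvisit hq).trans
      (mul_le_mul_right (hR s hs) q)
  have hq1 : q ≠ ∞ := ne_top_of_le_ne_top ENNReal.one_ne_top (iSup₂_le fun _ _ => prob_le_one)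
  have hq0 : q = 0 := by
    by_contra h
    exact hqa.not_gt (by simpa using ENNReal.mul_lt_mul_right h hq1 ha)
  have hle := M.law_le_mul_law_exists_mem R hE hshift hvisit hq
  rw [hq0, zero_mul, nonpos_iff_eq_zero] at hle
  exact measure_eq_zero_iff_ae_notMem.1 hle

end MarkovChain

section Rabin

variable {k : ℕ} {w : ℕ → Set (Marker k)}

lemma mem_rabin_iff : w ∈ rabin k ↔
    ∃ j, (∃ᶠ i in atTop, Marker.e j ∈ w i) ∧ ∀ᶠ i in atTop, Marker.f j ∉ w i := by
  simp only [rabin, Set.mem_ofPred_eq, ← Nat.frequently_atTop_iff_infinite, ← Set.not_infinite,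
    not_frequently]

lemma measurableSet_rabin (k : ℕ) : MeasurableSet (rabin k) := by
  have heq : rabin k = ⋃ j, {w | ∃ᶠ i in atTop, w i ∈ {m | Marker.e j ∈ m}} \
      {w | ∃ᶠ i in atTop, w i ∈ {m | Marker.f j ∈ m}} := by
    ext w
    simp only [mem_rabin_iff, Set.mem_iUnion, Set.mem_sdiff, Set.mem_ofPred_eq, not_frequently]
  rw [heq]
  exact MeasurableSet.iUnion fun j => (measurableSet_setOf_frequently_coord_mem _).diff
    (measurableSet_setOf_frequently_coord_mem _)

/-- The part of the word `w` in the window `[m, 2 m]`, which is the second half of its prefix of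
length `2 m`, contains the marker `e j` but not the marker `f j`. -/
def IsGoodWindow (j : Fin k) (w : ℕ → Set (Marker k)) (m : ℕ) : Prop :=
  (∃ i ∈ Set.Icc m (2 * m), Marker.e j ∈ w i) ∧ ∀ i ∈ Set.Icc m (2 * m), Marker.f j ∉ w i

/-- The words all of whose prefixes that consist of one or more complete blocks of `2 F` steps have
a good second half; the index `j` may depend on the prefix. -/
def goodBlocks (k F : ℕ) : Set (ℕ → Set (Marker k)) :=
  {w | ∀ b ≥ 1, ∃ j, IsGoodWindow j w (F * b)}

/-- The behaviour of almost every run of a finite chain: for every `j`, either `e j` keeps occurring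
in every late window and `f j` disappears, or `e j` disappears, or `f j` keeps occurring in every
late window. -/
def IsSettled (w : ℕ → Set (Marker k)) : Prop :=
  ∀ j, (HitsWindows (Marker.e j ∈ w ·) ∧ ∀ᶠ i in atTop, Marker.f j ∉ w i) ∨
    (∀ᶠ i in atTop, Marker.e j ∉ w i) ∨ HitsWindows (Marker.f j ∈ w ·)

lemma IsSettled.mem_rabin (hw : IsSettled w) {F : ℕ} (hF : 0 < F) (hgood : w ∈ goodBlocks k F) :
    w ∈ rabin k := by
  have hlate : Tendsto (fun b => F * b) atTop atTop :=
    (strictMono_mul_left_of_pos hF).tendsto_atTop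
  obtain ⟨j, hj⟩ : ∃ j, ∃ᶠ b in atTop, IsGoodWindow j w (F * b) := by
    by_contra h
    simp only [not_exists, not_frequently] at h
    obtain ⟨b, hb, hb1⟩ := ((eventually_all.2 h).and (eventually_ge_atTop 1)).exists
    obtain ⟨j, hj⟩ := hgood b hb1
    exact hb j hj
  refine mem_rabin_iff.2 ⟨j, ?_⟩
  obtain ⟨he, hf⟩ | he | hf := hw j
  · exact ⟨he.frequently, hf⟩
  · obtain ⟨b, ⟨⟨i, hi, hei⟩, -⟩, hb⟩ :=
      (hj.and_eventually (hlate.eventually (eventually_forall_ge_atTop.2 he))).exists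
    exact absurd hei (hb i hi.1)
  · obtain ⟨b, ⟨-, hb⟩, i, hi, hfi⟩ := (hj.and_eventually (hlate.eventually hf)).exists
    exact absurd hfi (hb i hi)

lemma IsSettled.eventually_mem_goodBlocks (hw : IsSettled w) (hrabin : w ∈ rabin k) :
    ∀ᶠ F in atTop, w ∈ goodBlocks k F := by
  obtain ⟨j, he, hf⟩ := mem_rabin_iff.1 hrabin
  have hwindow : HitsWindows (Marker.e j ∈ w ·) := by
    obtain ⟨h, -⟩ | h | h := hw j
    · exact h
    · exact absurd h he
    · exact absurd hf h.frequently
  filter_upwards [eventually_forall_ge_atTop.2 hwindow, eventually_forall_ge_atTop.2 hf]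
    with F hFe hFf b hb
  have hle : F ≤ F * b := Nat.le_mul_of_pos_right F hb
  exact ⟨j, hFe _ hle, fun i hi => hFf i (hle.trans hi.1)⟩

namespace MarkovChain

variable {S : Type} [Finite S] (M : MarkovChain (Set (Marker k)) S)

lemma ae_isSettled : ∀ᵐ ρ ∂M.law, IsSettled (M.obsSeq ρ) :=
  ae_all_iff.2 fun j => M.ae_trichotomy {s | Marker.e j ∈ M.obs s} {s | Marker.f j ∈ M.obs s}

lemma exists_law_mem_goodBlocks_pos (h : 0 < M.prob (rabin k)) :
    ∃ N, 0 < M.law {ρ | ∀ F ≥ N, M.obsSeq ρ ∈ goodBlocks k F} := by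
  by_contra! hnull
  refine h.ne' (measure_eq_zero_iff_ae_notMem.2 ?_)
  filter_upwards [M.ae_isSettled, ae_all_iff.2 fun N =>
    measure_eq_zero_iff_ae_notMem.1 (nonpos_iff_eq_zero.1 (hnull N))] with ρ hρ hnot hrabin
  obtain ⟨N, hN⟩ := eventually_atTop.1 (hρ.eventually_mem_goodBlocks hrabin)
  exact hnot N hN

end MarkovChain

end Rabin

section RestartProcess

variable {O S : Type}

instance : Finite Action :=
  Finite.of_surjective (fun b : Bool => if b then Action.r else Action.c) fun
    | .r => ⟨true, rfl⟩
    | .c => ⟨false, rfl⟩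

lemma Action.ne_r_iff {a : Action} : a ≠ .r ↔ a = .c := by cases a <;> simp

lemma restartCount_append_singleton (l : List (O × Action)) (x : O × Action) :
    restartCount (l ++ [x]) = restartCount l + if x.2 = .r then 1 else 0 := by
  simp [restartCount, List.count_append, List.count_singleton]

namespace Hist

/-- Nothing has been sampled since the last restart: the history is empty, or its last action is a
restart. -/
def IsFresh (π : Hist S Action) : Prop := ∀ h : π.1 ≠ [], (π.1.getLast h).2 = .r

/-- The history `π` continued through the states `x 0, …, x t` without restarts. The current state
of `π` is replaced by `x 0`, so that the notion is meant for sequences with `x 0 = π.2`. -/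
def extend (π : Hist S Action) (t : ℕ) (x : ℕ → S) : Hist S Action :=
  (π.1 ++ (List.range t).map fun i => (x i, Action.c), x t)

variable (π : Hist S Action) (t : ℕ) (x : ℕ → S)

@[simp]
lemma snd_extend : (π.extend t x).2 = x t := rfl

lemma fst_extend_zero : (π.extend 0 x).1 = π.1 := by simp [extend]

lemma fst_extend_succ : (π.extend (t + 1) x).1 = (π.extend t x).1 ++ [(x t, .c)] := by
  simp [extend, List.range_succ]

lemma extend_congr {t : ℕ} {x y : ℕ → S} (h : ∀ i ≤ t, x i = y i) : π.extend t x = π.extend t y :=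
  Prod.ext (congrArg (π.1 ++ ·) (List.map_congr_left fun i hi => by
    rw [h i (List.mem_range.1 hi).le])) (h t le_rfl)

lemma restartCount_extend : restartCount (π.extend t x).1 = restartCount π.1 := by
  induction t with
  | zero => rw [fst_extend_zero]
  | succ t ih => simp [fst_extend_succ, restartCount_append_singleton, ih]

end Hist

variable {M : MarkovChain O S} {σ : Strategy O Action}

namespace MarkovChain.IsPath

variable {ρ : ℕ → Hist S Action}

lemma fst_succ (hρ : (M.restartMDP.induced σ).IsPath ρ) (t : ℕ) :
    (ρ (t + 1)).1 = (ρ t).1 ++ [((ρ t).2, M.restartMDP.choice σ (ρ t))] := by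
  obtain ⟨s, -, hs⟩ := (PMF.mem_support_map_iff _ _ _).1 (hρ t)
  rw [← hs]

lemma snd_succ_mem_support (hρ : (M.restartMDP.induced σ).IsPath ρ) (t : ℕ) :
    (ρ (t + 1)).2 ∈ (M.restartMDP.Δ (ρ t).2 (M.restartMDP.choice σ (ρ t))).support := by
  obtain ⟨s, hs, h⟩ := (PMF.mem_support_map_iff _ _ _).1 (hρ t)
  rwa [← h]

lemma mem_restartSteps_iff (hρ : (M.restartMDP.induced σ).IsPath ρ) (t : ℕ) :
    t ∈ restartSteps ρ ↔ M.restartMDP.choice σ (ρ t) = .r := by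
  simp [restartSteps, hρ.fst_succ t]

lemma notMem_restartSteps_iff (hρ : (M.restartMDP.induced σ).IsPath ρ) (t : ℕ) :
    t ∉ restartSteps ρ ↔ M.restartMDP.choice σ (ρ t) = .c := by
  rw [hρ.mem_restartSteps_iff, ← ne_eq, Action.ne_r_iff]

lemma isFresh_succ_iff (hρ : (M.restartMDP.induced σ).IsPath ρ) (t : ℕ) :
    (ρ (t + 1)).IsFresh ↔ t ∈ restartSteps ρ := by
  simp [Hist.IsFresh, hρ.fst_succ t, hρ.mem_restartSteps_iff]

lemma snd_succ_of_mem_restartSteps (hρ : (M.restartMDP.induced σ).IsPath ρ) {t : ℕ}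
    (ht : t ∈ restartSteps ρ) : (ρ (t + 1)).2 = M.init := by
  have h := hρ.snd_succ_mem_support t
  rw [(hρ.mem_restartSteps_iff t).1 ht] at h
  exact (PMF.mem_support_pure_iff _ _).1 h

open Classical in
lemma restartCount_eq (hρ : (M.restartMDP.induced σ).IsPath ρ) (t : ℕ) :
    restartCount (ρ t).1 = restartCount (ρ 0).1 + Nat.count (· ∈ restartSteps ρ) t := by
  induction t with
  | zero => simp
  | succ t ih =>
    simp only [hρ.fst_succ t, restartCount_append_singleton, ih, Nat.count_succ, add_assoc,
      hρ.mem_restartSteps_iff]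

lemma frequently_isFresh_of_infinite (hρ : (M.restartMDP.induced σ).IsPath ρ)
    (hinf : (restartSteps ρ).Infinite) {p : ℕ → Prop} (hp : ∃ᶠ n in atTop, p n) :
    ∃ᶠ t in atTop, (ρ t).IsFresh ∧ (ρ t).2 = M.init ∧ p (restartCount (ρ t).1) := by
  classical
  refine frequently_atTop.2 fun a => ?_
  obtain ⟨n, hn, hpn⟩ := frequently_atTop.1 hp (restartCount (ρ 0).1 + a + 1)
  obtain ⟨m, rfl⟩ := Nat.exists_eq_add_of_le hn
  let u := Nat.nth (· ∈ restartSteps ρ) (a + m)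
  have hu : u ∈ restartSteps ρ := Nat.nth_mem_of_infinite hinf _
  have hau : a + m ≤ u := (Nat.nth_strictMono hinf).le_apply
  have hcount : restartCount (ρ (u + 1)).1 = restartCount (ρ 0).1 + a + 1 + m := by
    have hcount_u : Nat.count (· ∈ restartSteps ρ) u = a + m := Nat.count_nth_of_infinite hinf _
    rw [hρ.restartCount_eq, Nat.count_succ, if_pos hu, hcount_u]
    lia
  exact ⟨u + 1, by lia, (hρ.isFresh_succ_iff u).2 hu, hρ.snd_succ_of_mem_restartSteps hu,
    hcount ▸ hpn⟩

lemma eq_extend (hρ : (M.restartMDP.induced σ).IsPath ρ) (n : ℕ)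
    (hc : ∀ m < n, M.restartMDP.choice σ ((ρ 0).extend m (Prod.snd ∘ ρ)) = .c) :
    ρ n = (ρ 0).extend n (Prod.snd ∘ ρ) := by
  refine Prod.ext ?_ rfl
  induction n with
  | zero => rw [Hist.fst_extend_zero]
  | succ n ih =>
    have heq : ρ n = (ρ 0).extend n (Prod.snd ∘ ρ) :=
      Prod.ext (ih fun m hm => hc m (hm.trans n.lt_succ_self)) rfl
    rw [Hist.fst_extend_succ, hρ.fst_succ, ← heq, Function.comp_apply, heq, hc n n.lt_succ_self]

lemma restartSteps_eq_empty_iff (hρ : (M.restartMDP.induced σ).IsPath ρ) :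
    restartSteps ρ = ∅ ↔
      ∀ t, M.restartMDP.choice σ ((ρ 0).extend t (Prod.snd ∘ ρ)) = .c := by
  simp only [Set.eq_empty_iff_forall_notMem, hρ.notMem_restartSteps_iff]
  refine ⟨fun hc t => ?_, fun hc t => ?_⟩
  · induction t using Nat.strong_induction_on with
    | _ t ih => exact hρ.eq_extend t ih ▸ hc t
  · rw [hρ.eq_extend t fun m _ => hc m]
    exact hc t

lemma isFresh_tailStart (hρ : (M.restartMDP.induced σ).IsPath ρ) (h0 : ρ 0 = ([], M.init))
    (hfin : (restartSteps ρ).Finite) : (ρ (tailStart ρ)).IsFresh ∧ (ρ (tailStart ρ)).2 = M.init ∧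
      restartSteps (shift (tailStart ρ) ρ) = ∅ := by
  obtain hempty | hne := (restartSteps ρ).eq_empty_or_nonempty
  · have hstart : tailStart ρ = 0 := by simp [tailStart, hempty]
    have hshift : shift 0 ρ = ρ := funext fun i => by simp
    rw [hstart, h0, hshift]
    exact ⟨fun h => absurd rfl h, rfl, hempty⟩
  · obtain ⟨u, hu, hmax⟩ := hfin.exists_maximal hne
    have hstart : tailStart ρ = u + 1 := by
      refine IsGreatest.csSup_eq ⟨⟨u, hu, rfl⟩, ?_⟩
      rintro _ ⟨v, hv, rfl⟩
      have := hmax hv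
      lia
    rw [hstart]
    refine ⟨(hρ.isFresh_succ_iff u).2 hu, hρ.snd_succ_of_mem_restartSteps hu,
      Set.eq_empty_of_forall_notMem fun v (hv : u + 1 + v ∈ restartSteps ρ) => ?_⟩
    have := hmax hv
    lia

end MarkovChain.IsPath

lemma measurableSet_restartSteps_eq_empty :
    MeasurableSet {ρ : ℕ → Hist S Action | restartSteps ρ = ∅} := by
  have heq : {ρ : ℕ → Hist S Action | restartSteps ρ = ∅} =
      ⋂ t, {ρ | ρ (t + 1) ∈ {π | ∃ s, π.1.getLast? = some (s, .r)}}ᶜ := by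
    ext ρ
    simp [restartSteps, Set.eq_empty_iff_forall_notMem]
  rw [heq]
  exact MeasurableSet.iInter fun t => (measurableSet_setOf_coord_mem (t + 1) _).compl

namespace MarkovChain

variable (M σ)

lemma induced_P_extend_succ (π : Hist S Action) (x : ℕ → S) {n : ℕ}
    (hc : M.restartMDP.choice σ (π.extend n x) = .c) :
    (M.restartMDP.induced σ).P (π.extend n x) (π.extend (n + 1) x) = M.P (x n) (x (n + 1)) := by
  have hext : π.extend (n + 1) x = ((π.extend n x).1 ++ [(x n, .c)], x (n + 1)) :=
    Prod.ext (π.fst_extend_succ n x) rfl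
  have hinj : Function.Injective fun s : S => ((π.extend n x).1 ++ [(x n, Action.c)], s) :=
    Prod.mk_right_injective _
  have hP : (M.restartMDP.induced σ).P (π.extend n x) =
      (M.P (x n)).map fun s => ((π.extend n x).1 ++ [(x n, .c)], s) := by
    simp only [MDP.induced, hc, Hist.snd_extend]
    rfl
  rw [hP, hext, ← PMF.toOuterMeasure_apply_singleton, PMF.toOuterMeasure_map_apply,
    ← PMF.toOuterMeasure_apply_singleton, ← Set.image_singleton (a := x (n + 1)),
    hinj.preimage_image]

variable [Countable S]

lemma law_cylinder_extend {π : Hist S Action} (hinit : π.2 = M.init) (x : ℕ → S) (n : ℕ)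
    (hc : ∀ m < n, M.restartMDP.choice σ (π.extend m x) = .c) :
    ((M.restartMDP.induced σ).startAt π).law (PiNat.cylinder (π.extend · x) (n + 1)) =
      M.law (PiNat.cylinder x (n + 1)) := by
  induction n with
  | zero =>
    have hiff : π.extend 0 x = π ↔ x 0 = M.init := by
      rw [Prod.ext_iff, Hist.fst_extend_zero, Hist.snd_extend, hinit, eq_self, true_and]
    rw [zero_add, law_cylinder_one, law_cylinder_one, startAt_init]
    congr 1
    exact propext hiff
  | succ n ih =>
    rw [law_cylinder_succ, law_cylinder_succ, ih fun m hm => hc m (hm.trans n.lt_succ_self),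
      startAt_P, M.induced_P_extend_succ σ π x (hc n n.lt_succ_self)]

lemma ae_snd_mem_cylinder_iff (π : Hist S Action) (x : ℕ → S) (n : ℕ)
    (hc : ∀ m < n, M.restartMDP.choice σ (π.extend m x) = .c) :
    ∀ᵐ ρ ∂((M.restartMDP.induced σ).startAt π).law,
      Prod.snd ∘ ρ ∈ PiNat.cylinder x (n + 1) ↔ ρ ∈ PiNat.cylinder (π.extend · x) (n + 1) := by
  filter_upwards [((M.restartMDP.induced σ).startAt π).ae_isPath,
    ((M.restartMDP.induced σ).startAt π).ae_init] with ρ hρ h0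
  simp only [PiNat.mem_cylinder_iff, Nat.lt_succ_iff]
  refine ⟨fun h m hm => ?_, fun h m hm => congrArg Prod.snd (h m hm)⟩
  have hext (i : ℕ) (hi : i ≤ m) : Hist.extend (ρ 0) i (Prod.snd ∘ ρ) = π.extend i x := by
    rw [h0, startAt_init, π.extend_congr fun j hj => h j (hj.trans (hi.trans hm))]
  rw [← hext m le_rfl]
  exact MarkovChain.IsPath.eq_extend hρ m fun i hi => by
    rw [hext i hi.le]
    exact hc i (hi.trans_le hm)

lemma law_restartSteps_eq_empty_inter {π : Hist S Action} (hinit : π.2 = M.init) {B : Set (ℕ → S)}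
    (hB : MeasurableSet B) :
    ((M.restartMDP.induced σ).startAt π).law {ρ | restartSteps ρ = ∅ ∧ Prod.snd ∘ ρ ∈ B} =
      M.law {x | (∀ t, M.restartMDP.choice σ (π.extend t x) = .c) ∧ x ∈ B} := by
  let N := (M.restartMDP.induced σ).startAt π
  let D (n : ℕ) : Set (ℕ → S) := {x | ∀ m < n, M.restartMDP.choice σ (π.extend m x) = .c}
  have hD (n : ℕ) : DependsOn (· ∈ D n) (Set.Iic n) := fun x y h =>
    propext (forall₂_congr fun m hm => by
      rw [π.extend_congr fun i hi => h i (hi.trans hm.le)])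
  have hanti : Antitone D := fun m n hmn x hx i hi => hx i (hi.trans_le hmn)
  have hInter : ⋂ n, D n = {x | ∀ t, M.restartMDP.choice σ (π.extend t x) = .c} := by
    ext x
    simp only [D, Set.mem_iInter, Set.mem_ofPred_eq]
    exact ⟨fun h t => h (t + 1) t t.lt_succ_self, fun h _ t _ => h t⟩
  have hsnd := measurable_comp_left (Prod.snd : Hist S Action → S)
  have : IsFiniteMeasure (N.law.map fun ρ => Prod.snd ∘ ρ) := Measure.isFiniteMeasure_map _ _
  have hrestrict := measure_restrict_iInter_eq_of_dependsOn
    (μ := N.law.map fun ρ => Prod.snd ∘ ρ) (ν := M.law) hD hanti fun n x hx => by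
      rw [Measure.map_apply hsnd (measurableSet_cylinder x _),
        ← M.law_cylinder_extend σ hinit x n hx]
      exact measure_congr ((M.ae_snd_mem_cylinder_iff σ π x n hx).mono fun ρ h => propext h)
  have hDm : MeasurableSet (⋂ n, D n) :=
    MeasurableSet.iInter fun n => measurableSet_of_dependsOn (hD n)
  calc N.law {ρ | restartSteps ρ = ∅ ∧ Prod.snd ∘ ρ ∈ B}
      = N.law ((fun ρ => Prod.snd ∘ ρ) ⁻¹' (B ∩ ⋂ n, D n)) := by
        refine measure_congr ?_
        filter_upwards [N.ae_isPath, N.ae_init] with ρ hρ h0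
        refine propext ((and_comm.trans (and_congr_right fun _ => ?_)))
        rw [hInter, IsPath.restartSteps_eq_empty_iff hρ, h0]
        rfl
    _ = (N.law.map fun ρ => Prod.snd ∘ ρ).restrict (⋂ n, D n) B := by
        rw [Measure.restrict_apply hB, Measure.map_apply hsnd (hB.inter hDm)]
    _ = M.law {x | (∀ t, M.restartMDP.choice σ (π.extend t x) = .c) ∧ x ∈ B} := by
        rw [hrestrict, Measure.restrict_apply hB, hInter, Set.inter_comm]
        rfl

lemma ae_tail_mem_of_finite {L : Set (ℕ → O)} (hL : MeasurableSet L)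
    (h : ∀ π : Hist S Action, π.IsFresh → π.2 = M.init → ∀ᵐ x ∂M.law,
      (∀ t, M.restartMDP.choice σ (π.extend t x) = .c) → M.obsSeq x ∈ L) :
    ∀ᵐ ρ ∂(M.restartMDP.induced σ).law, (restartSteps ρ).Finite → M.tail ρ ∈ L := by
  let N := M.restartMDP.induced σ
  let E : Set (ℕ → Hist S Action) :=
    {ρ | restartSteps ρ = ∅ ∧ Prod.snd ∘ ρ ∈ {x | M.obsSeq x ∈ L}ᶜ}
  have hLm : MeasurableSet {x | M.obsSeq x ∈ L}ᶜ := (M.measurable_obsSeq hL).compl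
  have hE : MeasurableSet E :=
    measurableSet_restartSteps_eq_empty.inter (measurable_comp_left Prod.snd hLm)
  have hnull (t : ℕ) : ∀ᵐ ρ ∂N.law, ¬ ((ρ t).IsFresh ∧ (ρ t).2 = M.init ∧ shift t ρ ∈ E) := by
    have hle := N.law_inter_shift_le
      (dependsOn_coord_mem t {π : Hist S Action | π.IsFresh ∧ π.2 = M.init}) (fun ρ hρ => hρ) hE
      (c := 0) fun π hπ => by
        rw [M.law_restartSteps_eq_empty_inter σ hπ.2 hLm, nonpos_iff_eq_zero,
          measure_eq_zero_iff_ae_notMem]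
        exact (h π hπ.1 hπ.2).mono fun x hx hx' => hx'.2 (hx hx'.1)
    rw [zero_mul, nonpos_iff_eq_zero] at hle
    exact (measure_eq_zero_iff_ae_notMem.1 hle).mono fun ρ hρ h => hρ ⟨⟨h.1, h.2.1⟩, h.2.2⟩
  filter_upwards [N.ae_isPath, N.ae_init, ae_all_iff.2 hnull] with ρ hρ h0 hnot hfin
  obtain ⟨hfresh, hinit, hempty⟩ := IsPath.isFresh_tailStart hρ h0 hfin
  by_contra htail
  exact hnot (tailStart ρ) ⟨hfresh, hinit, hempty, htail⟩

end MarkovChain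

end RestartProcess

section Strategy

lemma mem_drop_map_range_iff {α : Type*} {w : ℕ → α} {m n : ℕ} {a : α} :
    a ∈ ((List.range n).map w).drop m ↔ ∃ i, m ≤ i ∧ i < n ∧ w i = a := by
  rw [List.mem_drop_iff_getElem]
  simp only [List.length_map, List.length_range, List.getElem_map, List.getElem_range]
  constructor
  · rintro ⟨i, hi, rfl⟩
    exact ⟨m + i, by lia, by lia, rfl⟩
  · rintro ⟨i, hmi, hin, rfl⟩
    exact ⟨i - m, by lia, by rw [Nat.add_sub_cancel' hmi]⟩

lemma pathLength_map_range {O : Type} (w : ℕ → O) (m : ℕ) :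
    pathLength ((List.range (m + 1)).map w) = m := by simp [pathLength]

lemma secondHalf_map_range {O : Type} (w : ℕ → O) (m : ℕ) :
    secondHalf ((List.range (2 * m + 1)).map w) = ((List.range (2 * m + 1)).map w).drop m := by
  rw [secondHalf, pathLength_map_range]
  congr 1
  lia

lemma restartCount_map {O S : Type} (o : S → O) (l : List (S × Action)) :
    restartCount (l.map fun y => (o y.1, y.2)) = restartCount l := by
  simp [restartCount, Function.comp_def]

lemma Hist.IsFresh.currentPath_extend {O S : Type} {π : Hist S Action} (hπ : π.IsFresh) (o : S → O)
    (t : ℕ) (x : ℕ → S) :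
    currentPath ((π.extend t x).1.map fun y => (o y.1, y.2)) (o (x t)) =
      (List.range (t + 1)).map fun i => o (x i) := by
  rw [List.range_succ, List.map_append, currentPath]
  congr 1
  induction t with
  | zero =>
    rw [fst_extend_zero, List.range_zero, List.map_nil, List.map_eq_nil_iff,
      List.rtakeWhile_eq_nil_iff]
    intro hne
    simp [hπ (List.map_eq_nil_iff.not.1 hne)]
  | succ t ih =>
    rw [fst_extend_succ, List.map_append, List.map_singleton,
      List.rtakeWhile_concat_pos _ _ _ (by simp), List.map_append, ih, List.range_succ,
      List.map_append]
    rfl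

variable {k : ℕ}

lemma isGood_secondHalf_map_range_iff {w : ℕ → Set (Marker k)} {m : ℕ} (hm : m ≠ 0) :
    IsGood (secondHalf ((List.range (2 * m + 1)).map w)) ↔ ∃ j, IsGoodWindow j w m := by
  have hlength : pathLength (((List.range (2 * m + 1)).map w).drop m) ≠ 0 := by
    rw [pathLength, List.length_drop, List.length_map, List.length_range]
    lia
  refine exists_congr fun j => ?_
  simp only [IsGoodFor, IsGoodWindow, secondHalf_map_range, hlength, false_or,
    mem_drop_map_range_iff, Set.mem_Icc, Nat.lt_succ_iff]
  refine and_congr ?_ ?_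
  · exact ⟨fun ⟨_, ⟨i, hmi, him, rfl⟩, he⟩ => ⟨i, ⟨hmi, him⟩, he⟩,
      fun ⟨i, ⟨hmi, him⟩, he⟩ => ⟨w i, ⟨i, hmi, him, rfl⟩, he⟩⟩
  · exact ⟨fun h i hi => h _ ⟨i, hi.1, hi.2, rfl⟩, fun h _ ⟨i, hmi, him, hi⟩ => hi ▸ h i ⟨hmi, him⟩⟩

lemma isGood_of_pathLength_eq_zero (hk : 1 ≤ k) {w : List (Set (Marker k))}
    (hw : pathLength w = 0) : IsGood w := ⟨⟨0, hk⟩, .inl hw⟩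

lemma strategyS_eq_c_iff (f : ℕ → ℕ) (h : List (Set (Marker k) × Action)) (o : Set (Marker k)) :
    strategyS k f h o = .c ↔ f (restartCount h) ≠ 0 ∧
      (2 * f (restartCount h) ∣ pathLength (currentPath h o) →
        IsGood (secondHalf (currentPath h o))) := by
  unfold strategyS
  split_ifs with hr
  · simp only [false_iff]
    tauto
  · simp only [true_iff]
    tauto

variable {S : Type} (M : MarkovChain (Set (Marker k)) S) (f : ℕ → ℕ)

lemma forall_choice_extend_eq_c_iff (hk : 1 ≤ k) {π : Hist S Action} (hπ : π.IsFresh)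
    (x : ℕ → S) :
    (∀ t, M.restartMDP.choice (strategyS k f) (π.extend t x) = .c) ↔
      f (restartCount π.1) ≠ 0 ∧ M.obsSeq x ∈ goodBlocks k (f (restartCount π.1)) := by
  have hchoice (t : ℕ) : M.restartMDP.choice (strategyS k f) (π.extend t x) = .c ↔
      f (restartCount π.1) ≠ 0 ∧ (2 * f (restartCount π.1) ∣ t →
        IsGood (secondHalf ((List.range (t + 1)).map (M.obsSeq x)))) := by
    have h := strategyS_eq_c_iff f ((π.extend t x).1.map fun y => (M.obs y.1, y.2)) (M.obs (x t))
    rwa [restartCount_map, π.restartCount_extend, hπ.currentPath_extend, pathLength_map_range] at h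
  simp only [hchoice, forall_and, forall_const]
  refine and_congr_right fun hf => ⟨fun h b hb => ?_, ?_⟩
  · have hne : f (restartCount π.1) * b ≠ 0 := Nat.mul_ne_zero hf (Nat.one_le_iff_ne_zero.1 hb)
    exact (isGood_secondHalf_map_range_iff hne).1 (h _ ⟨b, (mul_assoc _ _ _).symm⟩)
  · rintro h _ ⟨b, rfl⟩
    obtain rfl | hb := b.eq_zero_or_pos
    · exact isGood_of_pathLength_eq_zero hk (by simp [secondHalf, pathLength])
    · rw [mul_assoc]
      exact (isGood_secondHalf_map_range_iff (Nat.mul_ne_zero hf hb.ne')).2 (h b hb)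

section Unbounded

variable {M f} [Finite S]

lemma ae_finite_restartSteps (hk : 1 ≤ k) (hM : 0 < M.prob (rabin k))
    (hf : ∀ B, ∃ᶠ n in atTop, B ≤ f n) :
    ∀ᵐ ρ ∂(M.restartMDP.induced (strategyS k f)).law, (restartSteps ρ).Finite := by
  let N := M.restartMDP.induced (strategyS k f)
  obtain ⟨F₀, hF₀⟩ := M.exists_law_mem_goodBlocks_pos hM
  let p := M.law {x | ∀ F ≥ F₀, M.obsSeq x ∈ goodBlocks k F}
  let R : Set (Hist S Action) :=
    {π | π.IsFresh ∧ π.2 = M.init ∧ F₀ + 1 ≤ f (restartCount π.1)}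
  have hstay (π : Hist S Action) (hπ : π ∈ R) : p ≤ (N.startAt π).law {ρ | restartSteps ρ = ∅} := by
    obtain ⟨hfresh, hinit, hlarge⟩ := hπ
    have hlaw := M.law_restartSteps_eq_empty_inter (strategyS k f) hinit MeasurableSet.univ
    simp only [Set.mem_univ, and_true, forall_choice_extend_eq_c_iff M f hk hfresh] at hlaw
    refine hlaw.ge.trans' (measure_mono fun x hx => ?_)
    exact ⟨by lia, hx _ (by lia)⟩
  have hreturn (π : Hist S Action) (hπ : π ∈ R) :
      (N.startAt π).law {ρ | ∃ t, ρ (t + 1) ∈ R} ≤ 1 - p :=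
    calc (N.startAt π).law {ρ | ∃ t, ρ (t + 1) ∈ R}
        ≤ (N.startAt π).law {ρ | restartSteps ρ = ∅}ᶜ := by
          refine measure_mono_ae ?_
          filter_upwards [(N.startAt π).ae_isPath] with ρ hρ ⟨t, ht⟩ hempty
          have hmem := (MarkovChain.IsPath.isFresh_succ_iff hρ t).1 ht.1
          exact Set.eq_empty_iff_forall_notMem.1 hempty t hmem
      _ = 1 - (N.startAt π).law {ρ | restartSteps ρ = ∅} :=
          prob_compl_eq_one_sub measurableSet_restartSteps_eq_empty
      _ ≤ 1 - p := tsub_le_tsub_left (hstay π hπ) 1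
  filter_upwards [N.ae_isPath,
    N.ae_not_frequently_mem (ENNReal.sub_lt_self ENNReal.one_ne_top one_ne_zero hF₀.ne') hreturn]
    with ρ hρ hR
  by_contra hinf
  exact hR (MarkovChain.IsPath.frequently_isFresh_of_infinite hρ hinf (hf (F₀ + 1)))

lemma ae_tail_mem_rabin_of_finite (hk : 1 ≤ k) :
    ∀ᵐ ρ ∂(M.restartMDP.induced (strategyS k f)).law,
      (restartSteps ρ).Finite → M.tail ρ ∈ rabin k := by
  refine M.ae_tail_mem_of_finite _ (measurableSet_rabin k) fun π hfresh _ => ?_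
  filter_upwards [M.ae_isSettled] with x hx hchoice
  obtain ⟨hne, hgood⟩ := (forall_choice_extend_eq_c_iff M f hk hfresh x).1 hchoice
  exact hx.mem_rabin (Nat.pos_of_ne_zero hne) hgood

end Unbounded

theorem isTestingStrategy_strategyS (hk : 1 ≤ k) {f : ℕ → ℕ} (hf : ∀ B, ∃ᶠ n in atTop, B ≤ f n) :
    IsTestingStrategy (strategyS k f) (rabin k) := by
  intro S _ M hM
  filter_upwards [ae_finite_restartSteps hk hM hf, ae_tail_mem_rabin_of_finite hk] with ρ hfin htail
  exact ⟨Set.encard_lt_top_iff.2 hfin, htail hfin⟩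

/-- The chain that moves through the states `0, …, L` one by one, remains in `L`, and shows the
markers `e j` in `L` only. -/
noncomputable def climbingChain (k L : ℕ) : MarkovChain (Set (Marker k)) (Fin (L + 1)) where
  init := 0
  obs s := {m | s = Fin.last L ∧ ∃ j, m = Marker.e j}
  P s := PMF.pure ⟨min (s.1 + 1) L, by lia⟩

lemma mem_support_climbingChain {k L : ℕ} {s t : Fin (L + 1)} :
    t ∈ ((climbingChain k L).P s).support ↔ t.1 = min (s.1 + 1) L := by
  rw [climbingChain, PMF.mem_support_pure_iff, Fin.ext_iff]

lemma climbingChain_prob_rabin_pos (hk : 1 ≤ k) (L : ℕ) :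
    0 < (climbingChain k L).prob (rabin k) := by
  let M := climbingChain k L
  have hrabin : ∀ᵐ ρ ∂M.law, M.obsSeq ρ ∈ rabin k := by
    filter_upwards [M.ae_isPath, M.ae_init] with ρ hρ h0
    have hval (t : ℕ) : (ρ t).1 = min t L := by
      induction t with
      | zero => simp [h0, M, climbingChain]
      | succ t ih =>
        rw [mem_support_climbingChain.1 (hρ t), ih]
        lia
    refine mem_rabin_iff.2 ⟨⟨0, hk⟩, Eventually.frequently ?_, .of_forall ?_⟩
    · filter_upwards [eventually_ge_atTop L] with t ht
      exact ⟨Fin.ext ((hval t).trans (min_eq_right ht)), _, rfl⟩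
    · rintro t ⟨-, _, ⟨⟩⟩
  have hprob : M.prob (rabin k) = 1 :=
    (mem_ae_iff_prob_eq_one (M.measurable_obsSeq (measurableSet_rabin k))).1 hrabin
  exact hprob ▸ one_pos

lemma infinite_restartSteps_climbingChain (hk : 1 ≤ k) {f : ℕ → ℕ} {L : ℕ} (hL : ∀ n, 2 * f n < L)
    {ρ : ℕ → Hist (Fin (L + 1)) Action}
    (hρ : ((climbingChain k L).restartMDP.induced (strategyS k f)).IsPath ρ)
    (h0 : ρ 0 = ([], 0)) : (restartSteps ρ).Infinite := by
  intro hfin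
  let M := climbingChain k L
  obtain ⟨hfresh, hinit, hempty⟩ := hρ.isFresh_tailStart h0 hfin
  let ρ' := shift (tailStart ρ) ρ
  have hρ' : (M.restartMDP.induced (strategyS k f)).IsPath ρ' := fun t => hρ (tailStart ρ + t)
  have hval (t : ℕ) : (ρ' t).2.1 ≤ t := by
    induction t with
    | zero => exact (congrArg Fin.val hinit).le
    | succ t ih =>
      have hc := (hρ'.notMem_restartSteps_iff t).1 (hempty ▸ Set.notMem_empty t)
      have hmem := hρ'.snd_succ_mem_support t
      rw [hc] at hmem
      have := (mem_support_climbingChain (k := k)).1 hmem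
      lia
  have hgood := (forall_choice_extend_eq_c_iff M f hk hfresh _).1
    (hρ'.restartSteps_eq_empty_iff.1 hempty)
  obtain ⟨j, ⟨i, hi, hlast, -⟩, -⟩ := hgood.2 1 le_rfl
  have hiL : i < L := by
    have := hL (restartCount (ρ (tailStart ρ)).1)
    rw [mul_one] at hi
    exact hi.2.trans_lt this
  have : L ≤ i := (congrArg Fin.val hlast).ge.trans (hval i)
  lia

theorem not_isTestingStrategy_strategyS (hk : 1 ≤ k) {f : ℕ → ℕ} (hf : BddAbove (Set.range f)) :
    ¬ IsTestingStrategy (strategyS k f) (rabin k) := by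
  intro htest
  obtain ⟨B, hB⟩ := hf
  let L := 2 * B + 1
  let M := climbingChain k L
  let N := M.restartMDP.induced (strategyS k f)
  have hL (n : ℕ) : 2 * f n < L := by
    have := hB (Set.mem_range_self n)
    lia
  obtain ⟨ρ, ⟨hfin, -⟩, hρ, h0⟩ :=
    ((htest _ M (climbingChain_prob_rabin_pos hk L)).and (N.ae_isPath.and N.ae_init)).exists
  exact infinite_restartSteps_climbingChain hk hL hρ h0 (Set.encard_lt_top_iff.1 hfin)

end Strategy

lemma limsup_natCast_eq_top_iff (f : ℕ → ℕ) :
    limsup (fun n => (f n : ℕ∞)) atTop = ⊤ ↔ ∀ B, ∃ᶠ n in atTop, B ≤ f n := by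
  refine ⟨fun h B => ?_, fun h => ENat.eq_top_iff_forall_ge.2 fun B => ?_⟩
  · have hlt : (B : ℕ∞) < limsup (fun n => (f n : ℕ∞)) atTop := h ▸ ENat.natCast_lt_top B
    exact (frequently_lt_of_lt_limsup (by isBoundedDefault) hlt).mono fun n hn =>
      (Nat.cast_lt.1 hn).le
  · exact le_limsup_of_frequently_le ((h B).mono fun n hn => Nat.cast_le.2 hn)
      (by isBoundedDefault)

end BlackBoxTesting

theorem mainTheorem1 (k : ℕ) (hk : 1 ≤ k) (f : ℕ → ℕ) :
    BlackBoxTesting.IsTestingStrategy (BlackBoxTesting.strategyS k f) (BlackBoxTesting.rabin k) ↔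
      Filter.limsup (fun n => (f n : ℕ∞)) Filter.atTop = ⊤ := by
  rw [BlackBoxTesting.limsup_natCast_eq_top_iff]
  refine ⟨fun htest B => ?_, BlackBoxTesting.isTestingStrategy_strategyS hk⟩
  by_contra hbdd
  rw [Filter.not_frequently] at hbdd
  have hrange : BddAbove (Set.range f) := Filter.IsBoundedUnder.bddAbove_range
    ⟨B, Filter.eventually_map.2 (hbdd.mono fun n hn => (not_le.1 hn).le)⟩
  exact BlackBoxTesting.not_isTestingStrategy_strategyS hk hrange htest
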